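/- **Definitions.** A *multiplicative Lie algebra* is a group $(G,\cdot)$ (not necessarily abelian) with a second binary operation $\star$ such that for all $x,y,z\in G$, writing ${}^xy=xyx^{-1}$: $x\star x=1$; $x\star(yz)=(x\star y)\,{}^y(x\star z)$; $(xy)\star z={}^x(y\star z)\,(x\star z)$; $((x\star y)\star{}^yz)\,((y\star z)\star{}^zx)\,((z\star x)\star{}^xy)=1$; ${}^z(x\star y)={}^zx\star{}^zy$. Homomorphisms are group homomorphisms that preserve $\star$. An *ideal* of $G$ is a normal subgroup $H$ with $x\star y\in H$ for all $x\in G$, $y\in H$. Put $LZ(G)=\{x\in G: x\star y=1 \text{ for all } y\in G\}$ and $\mathcal{Z}(G)=LZ(G)\cap Z(G)$, where $Z(G)$ is the center of the group $G$. For an ideal $H$ of $G$ let ${}^M[G,H]=(G\star H)[G,H]$, where $G\star H$ is the ideal generated by all $a\star b$ with $a\in G$, $b\in H$, and $[G,H]$ is the usual commutator subgroup; for ${}^M[G,H]$ we also write ${}^M[H,G]$. A *central extension* of $G$ is a short exact sequence $1\to N\to E\xrightarrow{\phi}G\to1$ of multiplicative Lie algebras such that the image of $N$ is contained in $\mathcal{Z}(E)$.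 Let $\mathcal{Z}^*(G)$ be the intersection of the images $\phi(\mathcal{Z}(E))$ over all central extensions $1\to N\to E\xrightarrow{\phi}G\to1$ of $G$. The *Schur multiplier* of $G$ is $\tilde M(G)=({}^M[F,F]\cap R)/{}^M[R,F]$, where $1\to R\to F\to G\to1$ is a free presentation of $G$, that is, $F$ is a free multiplicative Lie algebra (up to isomorphism this does not depend on the presentation; for definiteness, take $F$ free on the set $G$, with $F\to G$ extending the identity). A *stem cover* of $G$ is a central extension $1\to N\to G^*\xrightarrow{\phi}G\to1$ such that the image of $N$ is contained in ${}^M[G^*,G^*]$ and $N\cong\tilde M(G)$. **Theorem.** Let $G$ be a multiplicative Lie algebra whose Schur multiplier $\tilde M(G)$ is finite, and let $1\to N\to G^*\xrightarrow{\phi}G\to1$ be a stem cover of $G$. Then $\mathcal{Z}^*(G)=\phi(\mathcal{Z}(G^*))$. -/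

import Mathlib

universe u v w

/-- A binary operation `x ⋆ₗ y` on a type. -/
class LieStar (G : Type u) where
  lstar : G → G → G

infixl:75 " ⋆ₗ " => LieStar.lstar

/-- A multiplicative Lie algebra: a group `G`, not necessarily abelian, with a second operation `⋆ₗ`
satisfying the five identities below. The conjugate `ˣy` is written out as `x * y * x⁻¹`. -/
class MultiplicativeLieAlgebra (G : Type u) extends Group G, LieStar G where
  star_self : ∀ x : G, x ⋆ₗ x = 1
  star_mul : ∀ x y z : G, x ⋆ₗ (y * z) = (x ⋆ₗ y) * (y * (x ⋆ₗ z) * y⁻¹)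
  mul_star : ∀ x y z : G, (x * y) ⋆ₗ z = (x * (y ⋆ₗ z) * x⁻¹) * (x ⋆ₗ z)
  jacobi : ∀ x y z : G,
    ((x ⋆ₗ y) ⋆ₗ (y * z * y⁻¹)) * ((y ⋆ₗ z) ⋆ₗ (z * x * z⁻¹)) * ((z ⋆ₗ x) ⋆ₗ (x * y * x⁻¹)) = 1
  conj_star : ∀ x y z : G, z * (x ⋆ₗ y) * z⁻¹ = (z * x * z⁻¹) ⋆ₗ (z * y * z⁻¹)

namespace MultiplicativeLieAlgebra

/-- Homomorphisms of multiplicative Lie algebras: group homomorphisms that preserve `⋆ₗ`. -/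
structure Hom (G : Type u) (H : Type v) [MultiplicativeLieAlgebra G] [MultiplicativeLieAlgebra H]
    extends G →* H where
  map_star' : ∀ x y : G, toFun (x ⋆ₗ y) = toFun x ⋆ₗ toFun y

instance {G : Type u} {H : Type v} [MultiplicativeLieAlgebra G] [MultiplicativeLieAlgebra H] :
    FunLike (Hom G H) G H where
  coe f := f.toFun
  coe_injective f g h := by
    obtain ⟨f, _⟩ := f
    obtain ⟨g, _⟩ := g
    have hfg : f = g := DFunLike.coe_injective h
    subst hfg
    rfl

instance {G : Type u} {H : Type v} [MultiplicativeLieAlgebra G] [MultiplicativeLieAlgebra H] :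
    MonoidHomClass (Hom G H) G H where
  map_mul f := f.map_mul'
  map_one f := f.map_one'

section Basic

variable {G : Type u} [MultiplicativeLieAlgebra G]

theorem one_star (z : G) : (1 : G) ⋆ₗ z = 1 := by
  have h := mul_star (1 : G) 1 z
  simpa using h

variable (G) in
/-- The Lie center `LZ(G)`. -/
def lieCenter : Subgroup G where
  carrier := {x | ∀ y : G, x ⋆ₗ y = 1}
  one_mem' := one_star
  mul_mem' := by
    intro a b ha hb y
    rw [mul_star, ha y, hb y]
    simp
  inv_mem' := by
    intro x hx y
    have h := mul_star x⁻¹ x y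
    rw [inv_mul_cancel, one_star, hx y] at h
    simpa using h.symm

variable (G) in
/-- The center `𝒵(G) = LZ(G) ∩ Z(G)`, where `Z(G)` is the center of the group `G`. -/
def center : Subgroup G := lieCenter G ⊓ Subgroup.center G

/-- Ideals: normal subgroups `H` such that `x ⋆ₗ y ∈ H` for all `x ∈ G` and `y ∈ H`. -/
structure IsIdeal (H : Subgroup G) : Prop where
  normal : H.Normal
  star_mem : ∀ x : G, ∀ y ∈ H, x ⋆ₗ y ∈ H

/-- The ideal generated by a subset. -/
def idealSpan (S : Set G) : Subgroup G := sInf {I : Subgroup G | IsIdeal I ∧ S ⊆ I}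

instance idealSpan_normal (S : Set G) : (idealSpan S).Normal where
  conj_mem := by
    intro n hn g
    rw [idealSpan, Subgroup.mem_sInf] at hn ⊢
    intro I hI
    exact hI.1.normal.conj_mem n (hn I hI) g

/-- `G ⋆ H`, the ideal of `G` generated by all `a ⋆ₗ b` with `a ∈ G` and `b ∈ H`. -/
def starIdeal (H : Subgroup G) : Subgroup G :=
  idealSpan {c : G | ∃ a : G, ∃ b ∈ H, a ⋆ₗ b = c}

/-- `ᴹ[G, H] = (G ⋆ H)[G, H]` for an ideal `H` of `G`. Both factors are normal subgroups, so that
their join is the set of products. -/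
def mCommutator (H : Subgroup G) : Subgroup G := starIdeal H ⊔ ⁅(⊤ : Subgroup G), H⁆

instance mCommutator_normal (H : Subgroup G) [H.Normal] : (mCommutator H).Normal := by
  unfold mCommutator starIdeal
  infer_instance

end Basic

/-- A central extension `1 ⟶ N ⟶ E ⟶ G ⟶ 1` of multiplicative Lie algebras, with maps `ι` and `φ`:
a short exact sequence in which the image of `N` lies in `Z(E) ∩ LZ(E)`. -/
structure IsCentralExtension {N : Type w} {E : Type v} {G : Type u} [MultiplicativeLieAlgebra N]
    [MultiplicativeLieAlgebra E] [MultiplicativeLieAlgebra G] (ι : Hom N E) (φ : Hom E G) :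
    Prop where
  injective : Function.Injective ι
  exact : ι.toMonoidHom.range = φ.toMonoidHom.ker
  surjective : Function.Surjective φ
  central : ι.toMonoidHom.range ≤ center E

/-- `𝒵*(G)`: the intersection of the images `φ(𝒵(E))` over all central extensions
`1 ⟶ A ⟶ E ⟶ G ⟶ 1` of `G`. -/
def zStar (G : Type u) [MultiplicativeLieAlgebra G] : Subgroup G :=
  sInf {H : Subgroup G | ∃ (A E : Type u) (_ : MultiplicativeLieAlgebra A)
    (_ : MultiplicativeLieAlgebra E) (ι : Hom A E) (φ : Hom E G),
    IsCentralExtension ι φ ∧ H = (center E).map φ.toMonoidHom}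

/-- Formal expressions in the operations of a multiplicative Lie algebra. -/
inductive FreeTerm (X : Type u) : Type u
  | of : X → FreeTerm X
  | one : FreeTerm X
  | mul : FreeTerm X → FreeTerm X → FreeTerm X
  | inv : FreeTerm X → FreeTerm X
  | star : FreeTerm X → FreeTerm X → FreeTerm X

namespace FreeTerm

/-- The congruence on expressions generated by the identities of a multiplicative Lie algebra. -/
inductive Rel {X : Type u} : FreeTerm X → FreeTerm X → Prop
  | refl (a : FreeTerm X) : Rel a a
  | symm {a b : FreeTerm X} : Rel a b → Rel b a
  | trans {a b c : FreeTerm X} : Rel a b → Rel b c → Rel a c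
  | mul_congr {a a' b b' : FreeTerm X} : Rel a a' → Rel b b' → Rel (a.mul b) (a'.mul b')
  | inv_congr {a a' : FreeTerm X} : Rel a a' → Rel a.inv a'.inv
  | star_congr {a a' b b' : FreeTerm X} : Rel a a' → Rel b b' → Rel (a.star b) (a'.star b')
  | mul_assoc (a b c : FreeTerm X) : Rel ((a.mul b).mul c) (a.mul (b.mul c))
  | one_mul (a : FreeTerm X) : Rel (one.mul a) a
  | inv_mul_cancel (a : FreeTerm X) : Rel (a.inv.mul a) one
  | star_self (x : FreeTerm X) : Rel (star x x) one
  | star_mul (x y z : FreeTerm X) :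
      Rel (x.star (y.mul z)) ((x.star y).mul ((y.mul (x.star z)).mul y.inv))
  | mul_star (x y z : FreeTerm X) :
      Rel ((x.mul y).star z) (((x.mul (y.star z)).mul x.inv).mul (x.star z))
  | jacobi (x y z : FreeTerm X) :
      Rel ((((x.star y).star ((y.mul z).mul y.inv)).mul
        ((y.star z).star ((z.mul x).mul z.inv))).mul
        ((z.star x).star ((x.mul y).mul x.inv))) one
  | conj_star (x y z : FreeTerm X) :
      Rel ((z.mul (x.star y)).mul z.inv)
        (((z.mul x).mul z.inv).star ((z.mul y).mul z.inv))

/-- Evaluation of an expression in a multiplicative Lie algebra. -/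
def eval {X : Type u} {G : Type v} [MultiplicativeLieAlgebra G] (f : X → G) : FreeTerm X → G
  | of x => f x
  | one => 1
  | mul a b => eval f a * eval f b
  | inv a => (eval f a)⁻¹
  | star a b => eval f a ⋆ₗ eval f b

theorem eval_eq {X : Type u} {G : Type v} [MultiplicativeLieAlgebra G] (f : X → G)
    {a b : FreeTerm X} (h : Rel a b) : eval f a = eval f b := by
  induction h with
  | refl a => rfl
  | symm _ ih => exact ih.symm
  | trans _ _ ih₁ ih₂ => exact ih₁.trans ih₂
  | mul_congr _ _ ih₁ ih₂ => simp only [eval, ih₁, ih₂]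
  | inv_congr _ ih => simp only [eval, ih]
  | star_congr _ _ ih₁ ih₂ => simp only [eval, ih₁, ih₂]
  | mul_assoc a b c => exact _root_.mul_assoc _ _ _
  | one_mul a => exact _root_.one_mul _
  | inv_mul_cancel a => exact _root_.inv_mul_cancel _
  | star_self x => exact MultiplicativeLieAlgebra.star_self _
  | star_mul x y z => exact MultiplicativeLieAlgebra.star_mul _ _ _
  | mul_star x y z => exact MultiplicativeLieAlgebra.mul_star _ _ _
  | jacobi x y z => exact MultiplicativeLieAlgebra.jacobi _ _ _
  | conj_star x y z => exact MultiplicativeLieAlgebra.conj_star _ _ _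

end FreeTerm

/-- The free multiplicative Lie algebra on `X`. -/
def Free (X : Type u) : Type u := Quot (FreeTerm.Rel (X := X))

namespace Free

variable {X : Type u}

instance : Mul (Free X) :=
  ⟨Quot.map₂ FreeTerm.mul (fun a _ _ h => .mul_congr (.refl a) h)
    (fun _ _ b h => .mul_congr h (.refl b))⟩

instance : One (Free X) := ⟨Quot.mk _ FreeTerm.one⟩

instance : Inv (Free X) := ⟨Quot.map FreeTerm.inv (fun _ _ h => .inv_congr h)⟩

instance : LieStar (Free X) :=
  ⟨Quot.map₂ FreeTerm.star (fun a _ _ h => .star_congr (.refl a) h)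
    (fun _ _ b h => .star_congr h (.refl b))⟩

instance : Group (Free X) :=
  Group.ofLeftAxioms
    (by rintro ⟨a⟩ ⟨b⟩ ⟨c⟩; exact Quot.sound (.mul_assoc a b c))
    (by rintro ⟨a⟩; exact Quot.sound (.one_mul a))
    (by rintro ⟨a⟩; exact Quot.sound (.inv_mul_cancel a))

instance : MultiplicativeLieAlgebra (Free X) where
  star_self := by rintro ⟨x⟩; exact Quot.sound (.star_self x)
  star_mul := by rintro ⟨x⟩ ⟨y⟩ ⟨z⟩; exact Quot.sound (.star_mul x y z)
  mul_star := by rintro ⟨x⟩ ⟨y⟩ ⟨z⟩; exact Quot.sound (.mul_star x y z)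
  jacobi := by rintro ⟨x⟩ ⟨y⟩ ⟨z⟩; exact Quot.sound (.jacobi x y z)
  conj_star := by rintro ⟨x⟩ ⟨y⟩ ⟨z⟩; exact Quot.sound (.conj_star x y z)

/-- The element represented by an expression. -/
def mk (a : FreeTerm X) : Free X := Quot.mk _ a

/-- The inclusion of the generators. -/
def of (x : X) : Free X := mk (FreeTerm.of x)

/-- The homomorphism out of the free multiplicative Lie algebra given by values on generators. -/
def lift {G : Type v} [MultiplicativeLieAlgebra G] (f : X → G) : Hom (Free X) G where
  toFun := Quot.lift (FreeTerm.eval f) (fun _ _ h => FreeTerm.eval_eq f h)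
  map_one' := rfl
  map_mul' := by rintro ⟨a⟩ ⟨b⟩; rfl
  map_star' := by rintro ⟨a⟩ ⟨b⟩; rfl

theorem lift_of {G : Type v} [MultiplicativeLieAlgebra G] (f : X → G) (x : X) :
    lift f (of x) = f x := rfl

theorem hom_ext {G : Type v} [MultiplicativeLieAlgebra G] {φ ψ : Hom (Free X) G}
    (h : ∀ x, φ (of x) = ψ (of x)) : φ = ψ := by
  apply DFunLike.ext
  rintro ⟨a⟩
  change φ (mk a) = ψ (mk a)
  induction a with
  | of x => exact h x
  | one => exact (map_one φ).trans (map_one ψ).symm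
  | mul a b iha ihb =>
    have e₁ := map_mul φ (mk a) (mk b)
    have e₂ := map_mul ψ (mk a) (mk b)
    rw [iha, ihb] at e₁
    exact e₁.trans e₂.symm
  | inv a iha =>
    have e₁ := map_inv φ (mk a)
    have e₂ := map_inv ψ (mk a)
    rw [iha] at e₁
    exact e₁.trans e₂.symm
  | star a b iha ihb =>
    have e₁ : φ (mk a ⋆ₗ mk b) = φ (mk a) ⋆ₗ φ (mk b) :=
      φ.map_star' _ _
    have e₂ : ψ (mk a ⋆ₗ mk b) = ψ (mk a) ⋆ₗ ψ (mk b) :=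
      ψ.map_star' _ _
    rw [iha, ihb] at e₁
    exact e₁.trans e₂.symm

end Free

/-- For a free presentation `π : F ⟶ G` with kernel `R`, the group `(ᴹ[F, F] ∩ R) / ᴹ[R, F]`. -/
abbrev HopfQuotient {X : Type u} {G : Type v} [MultiplicativeLieAlgebra G] (π : Hom (Free X) G) :
    Type u :=
  ↥(mCommutator (⊤ : Subgroup (Free X)) ⊓ π.toMonoidHom.ker) ⧸
    (mCommutator π.toMonoidHom.ker).subgroupOf
      (mCommutator (⊤ : Subgroup (Free X)) ⊓ π.toMonoidHom.ker)

/-- The Schur multiplier of `G`, computed from the canonical free presentation of `G`, whose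
generators are the elements of `G`. -/
abbrev SchurMultiplier (G : Type u) [MultiplicativeLieAlgebra G] : Type u :=
  HopfQuotient (Free.lift (id : G → G))

/-- A stem cover `1 ⟶ N ⟶ E ⟶ G ⟶ 1`: a central extension with `N ⊆ ᴹ[E, E]` (a stem extension)
such that `N` is isomorphic to the Schur multiplier of `G`. The operation `⋆ₗ` is trivial on `N` and
on the Schur multiplier, so an isomorphism of groups is meant. -/
structure IsStemCover {N : Type w} {E : Type v} {G : Type u} [MultiplicativeLieAlgebra N]
    [MultiplicativeLieAlgebra E] [MultiplicativeLieAlgebra G] (ι : Hom N E) (φ : Hom E G) :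
    Prop extends IsCentralExtension ι φ where
  stem : ι.toMonoidHom.range ≤ mCommutator (⊤ : Subgroup E)
  iso : Nonempty (N ≃* SchurMultiplier G)

end MultiplicativeLieAlgebra

/-!
Let `π : F ⟶ G` be the canonical free presentation, `R` its kernel and `K = ᴹ[R, F]`. Both sides of
the theorem are shown to be equal to `π(T)`, where `T = centerMod K` is the set of `x ∈ F` that
become central in `F / K`.

Since `K` is an ideal with `R / K` central, `F / K ⟶ G` is itself a central extension, which gives
`𝒵*(G) ≤ π(T)` (`zStar_le_map_centerMod`). Conversely, for every central extension `φ : E ⟶ G`,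
freeness gives `f : F ⟶ E` over `G`. It maps `R` into `ker φ`, hence kills `K`, and
`E = f(F) · ker φ` with `ker φ` central, so that `f` maps `T` into `𝒵(E)` and
`π(T) ≤ φ(𝒵(E))` (`map_mem_center_of_mem_centerMod`).

It remains to see `φ(𝒵(E)) ≤ π(T)` for a stem cover. As `E = f(F) · ker φ`, commutators and star
products in `E` are those of elements of `f(F)`, so that `ᴹ[E, E] ≤ f(ᴹ[F, F])`
(`IsCentralExtension.mCommutator_top_le`). Therefore `ker φ ≤ ᴹ[E, E]` implies that `f` is
surjective and that it induces a surjection from the Schur multiplier `(ᴹ[F, F] ∩ R) / K` onto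
`ker φ`. These are finite of equal order, so this surjection is injective: an element of `ᴹ[F, F]`
killed by `f` lies in `K` (`IsStemCover.mem_mCommutator_ker`). If `f x` is central, then all
`[x, w]` and `x ⋆ₗ w` are such elements, and `x ∈ T`.
-/

open scoped commutatorElement

namespace MultiplicativeLieAlgebra

/-! ### Star products, central elements and ideals -/

section Basic

variable {G : Type u} [MultiplicativeLieAlgebra G]

theorem Hom.map_star {E : Type v} [MultiplicativeLieAlgebra E] (f : Hom G E) (x y : G) :
    f (x ⋆ₗ y) = f x ⋆ₗ f y :=
  f.map_star' x y

/-- The star product is antisymmetric; expand `(x * y) ⋆ₗ (x * y) = 1`. -/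
theorem star_mul_star_swap (x y : G) : (y ⋆ₗ x) * (x ⋆ₗ y) = 1 := by
  have h := star_self (x * y)
  rw [star_mul, mul_star x y x, mul_star x y y, star_self, star_self] at h
  have h' : x * ((y ⋆ₗ x) * (x ⋆ₗ y)) * x⁻¹ = 1 := by
    rw [← h]; group
  simpa using h'

theorem star_eq_inv (x y : G) : x ⋆ₗ y = (y ⋆ₗ x)⁻¹ :=
  eq_inv_of_mul_eq_one_right (star_mul_star_swap x y)

theorem IsIdeal.star_mem_left {I : Subgroup G} (hI : IsIdeal I) {x : G} (hx : x ∈ I) (y : G) :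
    x ⋆ₗ y ∈ I := by
  rw [star_eq_inv]
  exact I.inv_mem (hI.star_mem y x hx)

theorem mem_center_iff {x : G} : x ∈ center G ↔ ∀ y, x ⋆ₗ y = 1 ∧ ⁅x, y⁆ = 1 := by
  have h : x ∈ center G ↔ (∀ y, x ⋆ₗ y = 1) ∧ ∀ y, y * x = x * y :=
    and_congr Iff.rfl Subgroup.mem_center_iff
  simp only [h, forall_and, commutatorElement_eq_one_iff_mul_comm, eq_comm]

theorem star_eq_one_of_mem_center {a : G} (ha : a ∈ center G) (x : G) : x ⋆ₗ a = 1 := by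
  rw [star_eq_inv, ha.1 x, inv_one]

theorem commute_of_mem_center {a : G} (ha : a ∈ center G) (x : G) : Commute a x :=
  commutatorElement_eq_one_iff_commute.1 (mem_center_iff.1 ha x).2

theorem star_mul_of_mem_center {a : G} (ha : a ∈ center G) (x y : G) :
    x ⋆ₗ (y * a) = x ⋆ₗ y := by
  rw [star_mul, star_eq_one_of_mem_center ha]
  simp

theorem mul_star_of_mem_center {a : G} (ha : a ∈ center G) (x y : G) :
    (x * a) ⋆ₗ y = x ⋆ₗ y := by
  rw [mul_star, ha.1 y]
  simp

theorem mul_conj_of_mem_center {a : G} (ha : a ∈ center G) (x y : G) :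
    (x * a) * y * (x * a)⁻¹ = x * y * x⁻¹ := by
  have h := (commute_of_mem_center ha y).eq
  rw [mul_assoc x a y, h]
  group

theorem commutator_mul_of_mem_center {a : G} (ha : a ∈ center G) (x y : G) :
    ⁅x, y * a⁆ = ⁅x, y⁆ := by
  rw [commutatorElement_def, commutatorElement_def, mul_assoc (x * (y * a)), ← mul_assoc x y a,
    ← (commute_of_mem_center ha (x * y)).eq]
  have h := (commute_of_mem_center ha (x * y * x⁻¹)).eq
  calc a * (x * y) * (x⁻¹ * (y * a)⁻¹) = (a * (x * y * x⁻¹)) * a⁻¹ * y⁻¹ := by group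
    _ = _ := by rw [h]; group

theorem mul_commutator_of_mem_center {a : G} (ha : a ∈ center G) (x y : G) :
    ⁅x * a, y⁆ = ⁅x, y⁆ := by
  rw [commutatorElement_def, commutatorElement_def, mul_conj_of_mem_center ha]

theorem subset_idealSpan (S : Set G) : S ⊆ idealSpan S := fun _ hx =>
  Subgroup.mem_sInf.2 fun _ hI => hI.2 hx

theorem idealSpan_le {S : Set G} {I : Subgroup G} (hI : IsIdeal I) (hS : S ⊆ I) :
    idealSpan S ≤ I :=
  sInf_le ⟨hI, hS⟩

theorem star_mem_mCommutator {H : Subgroup G} (x : G) {y : G} (hy : y ∈ H) :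
    x ⋆ₗ y ∈ mCommutator H :=
  (le_sup_left : starIdeal H ≤ _) (subset_idealSpan _ ⟨x, y, hy, rfl⟩)

theorem commutator_mem_mCommutator {H : Subgroup G} (x : G) {y : G} (hy : y ∈ H) :
    ⁅x, y⁆ ∈ mCommutator H :=
  (le_sup_right : ⁅(⊤ : Subgroup G), H⁆ ≤ _)
    (Subgroup.commutator_mem_commutator (Subgroup.mem_top x) hy)

/-- To bound `ᴹ[G, H]` by an ideal, it suffices to look at star products and commutators. -/
theorem mCommutator_le {H I : Subgroup G} (hI : IsIdeal I) (hstar : ∀ x, ∀ y ∈ H, x ⋆ₗ y ∈ I)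
    (hcomm : ∀ x : G, ∀ y ∈ H, ⁅x, y⁆ ∈ I) : mCommutator H ≤ I := by
  refine sup_le (idealSpan_le hI ?_) (Subgroup.commutator_le.2 fun x _ y hy => hcomm x y hy)
  rintro _ ⟨x, y, hy, rfl⟩
  exact hstar x y hy

theorem IsIdeal.mCommutator_le_self {H : Subgroup G} (hH : IsIdeal H) : mCommutator H ≤ H :=
  mCommutator_le hH hH.star_mem fun x y hy =>
    H.mul_mem (hH.normal.conj_mem y hy x) (H.inv_mem hy)

theorem IsIdeal.mCommutator {H : Subgroup G} (hH : IsIdeal H) : IsIdeal (mCommutator H) where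
  normal := by
    have := hH.normal
    infer_instance
  star_mem x _ hy := star_mem_mCommutator x (hH.mCommutator_le_self hy)

theorem isIdeal_top : IsIdeal (⊤ : Subgroup G) where
  normal := inferInstance
  star_mem _ _ _ := Subgroup.mem_top _

theorem isIdeal_ker {E : Type v} [MultiplicativeLieAlgebra E] (f : Hom G E) :
    IsIdeal f.toMonoidHom.ker where
  normal := inferInstance
  star_mem x y hy := by
    have hy' : f y = 1 := hy
    change f (x ⋆ₗ y) = 1
    rw [f.map_star, hy', star_eq_inv, one_star, inv_one]

end Basic

/-! ### Subalgebras and quotients by ideals -/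

section Quotient

variable {G : Type u} [MultiplicativeLieAlgebra G]

/-- An ideal, with the operations of the ambient algebra. -/
abbrev idealAlgebra {I : Subgroup G} (hI : IsIdeal I) : MultiplicativeLieAlgebra I where
  toGroup := inferInstance
  lstar x y := ⟨(x : G) ⋆ₗ (y : G), hI.star_mem x y y.2⟩
  star_self x := Subtype.ext (star_self (x : G))
  star_mul x y z := Subtype.ext (star_mul (x : G) y z)
  mul_star x y z := Subtype.ext (mul_star (x : G) y z)
  jacobi x y z := Subtype.ext (jacobi (x : G) y z)
  conj_star x y z := Subtype.ext (conj_star (x : G) y z)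

theorem IsIdeal.star_congr {I : Subgroup G} (hI : IsIdeal I) {x x' y y' : G}
    (hx : x⁻¹ * x' ∈ I) (hy : y⁻¹ * y' ∈ I) : (x ⋆ₗ y)⁻¹ * (x' ⋆ₗ y') ∈ I := by
  have := hI.normal
  obtain ⟨a, rfl⟩ : ∃ a, x' = x * a := ⟨x⁻¹ * x', by group⟩
  obtain ⟨b, rfl⟩ : ∃ b, y' = y * b := ⟨y⁻¹ * y', by group⟩
  rw [inv_mul_cancel_left] at hx hy
  have h₁ : x * (a ⋆ₗ (y * b)) * x⁻¹ ∈ I :=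
    hI.normal.conj_mem _ (hI.star_mem_left hx _) x
  have h₂ : y * (x ⋆ₗ b) * y⁻¹ ∈ I := hI.normal.conj_mem _ (hI.star_mem x b hy) y
  rw [mul_star, star_mul x y b, ← mul_assoc, ← mul_assoc]
  refine I.mul_mem ?_ h₂
  simpa [mul_assoc] using hI.normal.conj_mem _ h₁ (x ⋆ₗ y)⁻¹

/-- The quotient by an ideal. -/
abbrev quotientAlgebra (I : Subgroup G) [I.Normal] (hI : IsIdeal I) :
    MultiplicativeLieAlgebra (G ⧸ I) where
  toGroup := inferInstance
  lstar := Quotient.map₂ (fun x y => x ⋆ₗ y) fun _ _ hx _ _ hy =>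
    QuotientGroup.leftRel_apply.2
      (hI.star_congr (QuotientGroup.leftRel_apply.1 hx) (QuotientGroup.leftRel_apply.1 hy))
  star_self := by
    rintro ⟨x⟩; exact congrArg (QuotientGroup.mk (s := I)) (star_self x)
  star_mul := by
    rintro ⟨x⟩ ⟨y⟩ ⟨z⟩; exact congrArg (QuotientGroup.mk (s := I)) (star_mul x y z)
  mul_star := by
    rintro ⟨x⟩ ⟨y⟩ ⟨z⟩; exact congrArg (QuotientGroup.mk (s := I)) (mul_star x y z)
  jacobi := by
    rintro ⟨x⟩ ⟨y⟩ ⟨z⟩; exact congrArg (QuotientGroup.mk (s := I)) (jacobi x y z)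
  conj_star := by
    rintro ⟨x⟩ ⟨y⟩ ⟨z⟩; exact congrArg (QuotientGroup.mk (s := I)) (conj_star x y z)

/-- The set of elements that become central modulo `I`. -/
def centerMod (I : Subgroup G) : Set G := {x | ∀ y, x ⋆ₗ y ∈ I ∧ ⁅x, y⁆ ∈ I}

end Quotient

/-! ### The universal central extension `F / ᴹ[R, F]` -/

section Presentation

variable {F : Type u} {G : Type u} [MultiplicativeLieAlgebra F] [MultiplicativeLieAlgebra G]

/-- The central extension `F / ᴹ[R, F] ⟶ G` bounds `𝒵*(G)` from above. -/
theorem zStar_le_map_centerMod (π : Hom F G) (hπ : Function.Surjective π) {x : G}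
    (hx : x ∈ zStar G) : ∃ t ∈ centerMod (mCommutator π.toMonoidHom.ker), π t = x := by
  set K := mCommutator π.toMonoidHom.ker
  have hR := isIdeal_ker π
  have hKI : IsIdeal K := hR.mCommutator
  let _ : MultiplicativeLieAlgebra (F ⧸ K) := quotientAlgebra K hKI
  let ρ : Hom (F ⧸ K) G :=
    { toMonoidHom := QuotientGroup.lift K π.toMonoidHom hR.mCommutator_le_self
      map_star' := by rintro ⟨a⟩ ⟨b⟩; exact π.map_star a b }
  let _ : MultiplicativeLieAlgebra ρ.toMonoidHom.ker := idealAlgebra (isIdeal_ker ρ)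
  let ι : Hom ρ.toMonoidHom.ker (F ⧸ K) :=
    { toMonoidHom := ρ.toMonoidHom.ker.subtype
      map_star' := fun _ _ => rfl }
  have mem_center : ∀ t : F, (t : F ⧸ K) ∈ center (F ⧸ K) ↔ t ∈ centerMod K := by
    intro t
    rw [mem_center_iff]
    constructor
    · intro h y
      exact ⟨(QuotientGroup.eq_one_iff _).1 (h (y : F ⧸ K)).1,
        (QuotientGroup.eq_one_iff _).1 (h (y : F ⧸ K)).2⟩
    · rintro h ⟨y⟩
      exact ⟨(QuotientGroup.eq_one_iff _).2 (h y).1, (QuotientGroup.eq_one_iff _).2 (h y).2⟩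
  have hrange : ι.toMonoidHom.range = ρ.toMonoidHom.ker := Subgroup.range_subtype _
  have hext : IsCentralExtension ι ρ :=
    { injective := Subtype.val_injective
      exact := hrange
      surjective := fun g => let ⟨t, ht⟩ := hπ g; ⟨(t : F ⧸ K), ht⟩
      central := by
        rw [hrange]
        rintro ⟨r⟩ hr
        have hr' : r ∈ π.toMonoidHom.ker := hr
        refine (mem_center r).2 fun y => ⟨?_, ?_⟩
        · rw [star_eq_inv]
          exact K.inv_mem (star_mem_mCommutator y hr')
        · rw [← commutatorElement_inv]
          exact K.inv_mem (commutator_mem_mCommutator y hr') }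
  obtain ⟨⟨t⟩, ht, rfl⟩ := (Subgroup.mem_sInf.1 hx) _ ⟨_, _, _, _, ι, ρ, hext, rfl⟩
  exact ⟨t, (mem_center t).1 ht, rfl⟩

end Presentation

/-! ### Comparison with an arbitrary central extension -/

section Comparison

variable {N : Type w} {E : Type v} {G : Type u} {F : Type u} [MultiplicativeLieAlgebra N]
  [MultiplicativeLieAlgebra E] [MultiplicativeLieAlgebra G] [MultiplicativeLieAlgebra F]
  {ι : Hom N E} {φ : Hom E G} {π : Hom F G} {f : Hom F E}

theorem IsCentralExtension.mem_center (h : IsCentralExtension ι φ) {e : E} (he : φ e = 1) :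
    e ∈ center E :=
  h.central (h.exact.symm ▸ he)

theorem IsCentralExtension.exists_eq_mul (h : IsCentralExtension ι φ)
    (hπ : Function.Surjective π) (hf : ∀ w, φ (f w) = π w) (e : E) :
    ∃ w, ∃ a ∈ center E, φ a = 1 ∧ e = f w * a := by
  obtain ⟨w, hw⟩ := hπ (φ e)
  have ha : φ ((f w)⁻¹ * e) = 1 := by
    rw [map_mul, map_inv, hf, hw, inv_mul_cancel]
  exact ⟨w, _, h.mem_center ha, ha, by group⟩

/-- A map to a central extension over `G` kills `ᴹ[R, F]`, because it sends `R` to the center. -/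
theorem IsCentralExtension.mCommutator_ker_le (h : IsCentralExtension ι φ)
    (hf : ∀ w, φ (f w) = π w) : mCommutator π.toMonoidHom.ker ≤ f.toMonoidHom.ker := by
  have hc : ∀ r ∈ π.toMonoidHom.ker, f r ∈ center E := fun r hr =>
    h.mem_center ((hf r).trans hr)
  refine mCommutator_le (isIdeal_ker f) (fun x y hy => ?_) fun x y hy => ?_
  · exact (f.map_star x y).trans (star_eq_one_of_mem_center (hc y hy) _)
  · exact (map_commutatorElement f x y).trans
      (commutatorElement_eq_one_iff_commute.2 (commute_of_mem_center (hc y hy) _).symm)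

theorem map_mem_center_of_mem_centerMod (h : IsCentralExtension ι φ)
    (hπ : Function.Surjective π) (hf : ∀ w, φ (f w) = π w) {t : F}
    (ht : t ∈ centerMod (mCommutator π.toMonoidHom.ker)) : f t ∈ center E := by
  refine mem_center_iff.2 fun e => ?_
  obtain ⟨w, a, ha, -, rfl⟩ := h.exists_eq_mul hπ hf e
  rw [star_mul_of_mem_center ha, commutator_mul_of_mem_center ha, ← f.map_star,
    ← map_commutatorElement f]
  exact ⟨h.mCommutator_ker_le hf (ht w).1, h.mCommutator_ker_le hf (ht w).2⟩

theorem IsCentralExtension.mCommutator_top_le (h : IsCentralExtension ι φ)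
    (hπ : Function.Surjective π) (hf : ∀ w, φ (f w) = π w) :
    mCommutator (⊤ : Subgroup E) ≤ (mCommutator (⊤ : Subgroup F)).map f.toMonoidHom := by
  have hI : IsIdeal (mCommutator (⊤ : Subgroup F)) := isIdeal_top.mCommutator
  refine mCommutator_le ⟨⟨?_⟩, ?_⟩ ?_ ?_
  · rintro _ ⟨x, hx, rfl⟩ e
    obtain ⟨w, a, ha, -, rfl⟩ := h.exists_eq_mul hπ hf e
    rw [mul_conj_of_mem_center ha]
    exact ⟨w * x * w⁻¹, hI.normal.conj_mem x hx w, by simp; rfl⟩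
  · rintro e _ ⟨x, hx, rfl⟩
    obtain ⟨w, a, ha, -, rfl⟩ := h.exists_eq_mul hπ hf e
    rw [mul_star_of_mem_center ha]
    exact ⟨w ⋆ₗ x, hI.star_mem w x hx, f.map_star w x⟩
  · rintro e e' -
    obtain ⟨w, a, ha, -, rfl⟩ := h.exists_eq_mul hπ hf e
    obtain ⟨w', a', ha', -, rfl⟩ := h.exists_eq_mul hπ hf e'
    rw [mul_star_of_mem_center ha, star_mul_of_mem_center ha']
    exact ⟨w ⋆ₗ w', star_mem_mCommutator w (Subgroup.mem_top w'), f.map_star w w'⟩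
  · rintro e e' -
    obtain ⟨w, a, ha, -, rfl⟩ := h.exists_eq_mul hπ hf e
    obtain ⟨w', a', ha', -, rfl⟩ := h.exists_eq_mul hπ hf e'
    rw [mul_commutator_of_mem_center ha, commutator_mul_of_mem_center ha']
    exact ⟨⁅w, w'⁆, commutator_mem_mCommutator w (Subgroup.mem_top w'),
      map_commutatorElement f w w'⟩

end Comparison

/-! ### Stem covers -/

section StemCover

variable {N : Type w} {E : Type v} {G : Type u} [MultiplicativeLieAlgebra N]
  [MultiplicativeLieAlgebra E] [MultiplicativeLieAlgebra G] {ι : Hom N E} {φ : Hom E G}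

theorem surjective_lift_id : Function.Surjective (Free.lift (id : G → G)) := fun g =>
  ⟨Free.of g, rfl⟩

theorem IsCentralExtension.exists_lift (h : IsCentralExtension ι φ) :
    ∃ f : Hom (Free G) E, ∀ w, φ (f w) = Free.lift (id : G → G) w := by
  choose s hs using h.surjective
  let f : Hom (Free G) E := Free.lift s
  let φf : Hom (Free G) G :=
    { toMonoidHom := φ.toMonoidHom.comp f.toMonoidHom
      map_star' := fun x y => (congrArg φ (f.map_star x y)).trans (φ.map_star _ _) }
  have hφf : φf = Free.lift (id : G → G) := Free.hom_ext hs
  exact ⟨f, fun w => DFunLike.congr_fun hφf w⟩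

theorem IsStemCover.exists_mem_mCommutator (h : IsStemCover ι φ) {f : Hom (Free G) E}
    (hf : ∀ w, φ (f w) = Free.lift (id : G → G) w) {e : E} (he : φ e = 1) :
    ∃ x ∈ mCommutator (⊤ : Subgroup (Free G)) ⊓ (Free.lift (id : G → G)).toMonoidHom.ker,
      f x = e := by
  have hmem : e ∈ ι.toMonoidHom.range := h.exact.symm ▸ he
  obtain ⟨x, hx, rfl⟩ :=
    h.toIsCentralExtension.mCommutator_top_le surjective_lift_id hf (h.stem hmem)
  exact ⟨x, ⟨hx, (hf x).symm.trans he⟩, rfl⟩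

theorem IsStemCover.surjective_lift (h : IsStemCover ι φ) {f : Hom (Free G) E}
    (hf : ∀ w, φ (f w) = Free.lift (id : G → G) w) : Function.Surjective f := by
  intro e
  obtain ⟨w, a, -, ha, rfl⟩ := h.toIsCentralExtension.exists_eq_mul surjective_lift_id hf e
  obtain ⟨x, -, rfl⟩ := h.exists_mem_mCommutator hf ha
  exact ⟨w * x, map_mul f w x⟩

/-- The map from the Schur multiplier to the kernel of a stem cover is a surjection between finite
groups of equal order, and therefore injective. -/
theorem IsStemCover.mem_mCommutator_ker (hfin : Finite (SchurMultiplier G))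
    (h : IsStemCover ι φ) {f : Hom (Free G) E}
    (hf : ∀ w, φ (f w) = Free.lift (id : G → G) w) {x : Free G}
    (hx : x ∈ mCommutator (⊤ : Subgroup (Free G))) (hfx : f x = 1) :
    x ∈ mCommutator (Free.lift (id : G → G)).toMonoidHom.ker := by
  set S := mCommutator (⊤ : Subgroup (Free G)) ⊓ (Free.lift (id : G → G)).toMonoidHom.ker
  let θ : SchurMultiplier G →* E :=
    QuotientGroup.lift _ (f.toMonoidHom.comp S.subtype) fun y hy =>
      h.toIsCentralExtension.mCommutator_ker_le hf hy
  have hθ : ∀ q, θ q ∈ ι.toMonoidHom.range := by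
    rintro ⟨y⟩
    rw [h.exact]
    exact (hf y).trans y.2.2
  let θ' : SchurMultiplier G → ι.toMonoidHom.range := fun q => ⟨θ q, hθ q⟩
  have hsurj : Function.Surjective θ' := by
    rintro ⟨e, he⟩
    rw [h.exact] at he
    obtain ⟨y, hy, hye⟩ := h.exists_mem_mCommutator hf he
    exact ⟨QuotientGroup.mk (⟨y, hy⟩ : S), Subtype.ext hye⟩
  obtain ⟨iso⟩ := h.iso
  let e : SchurMultiplier G ≃ ι.toMonoidHom.range :=
    iso.symm.toEquiv.trans (Equiv.ofInjective ι h.injective)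
  have hinj : Function.Injective θ' := (Finite.injective_iff_surjective_of_equiv e).2 hsurj
  have hxS : x ∈ S := ⟨hx, (hf x).symm.trans ((congrArg φ hfx).trans (map_one φ))⟩
  have hq : (QuotientGroup.mk (⟨x, hxS⟩ : S) : SchurMultiplier G) = 1 :=
    hinj (Subtype.ext (hfx.trans (map_one θ).symm))
  exact Subgroup.mem_subgroupOf.1 ((QuotientGroup.eq_one_iff (⟨x, hxS⟩ : S)).1 hq)

end StemCover

end MultiplicativeLieAlgebra

open MultiplicativeLieAlgebra in
theorem theoremC12 {N : Type w} {Gstar : Type v} {G : Type u}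
    [MultiplicativeLieAlgebra N] [MultiplicativeLieAlgebra Gstar] [MultiplicativeLieAlgebra G]
    (hfin : Finite (MultiplicativeLieAlgebra.SchurMultiplier G))
    (ι : MultiplicativeLieAlgebra.Hom N Gstar) (φ : MultiplicativeLieAlgebra.Hom Gstar G)
    (hcover : MultiplicativeLieAlgebra.IsStemCover ι φ) :
    MultiplicativeLieAlgebra.zStar G =
      (MultiplicativeLieAlgebra.center Gstar).map φ.toMonoidHom := by
  have hext := hcover.toIsCentralExtension
  apply le_antisymm
  · intro x hx
    obtain ⟨f, hf⟩ := hext.exists_lift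
    -- The extensions defining `zStar G` live in the universe of `G`, which need not contain `Gstar`;
    -- `zStar_le_map_centerMod` bounds `zStar G` without using `Gstar` as one of them.
    obtain ⟨t, ht, rfl⟩ := zStar_le_map_centerMod _ surjective_lift_id hx
    exact ⟨f t, map_mem_center_of_mem_centerMod hext surjective_lift_id hf ht, hf t⟩
  · rintro _ ⟨z, hz, rfl⟩
    obtain ⟨f, hf⟩ := hext.exists_lift
    obtain ⟨t, rfl⟩ := hcover.surjective_lift hf z
    have ht : t ∈ centerMod (mCommutator (Free.lift (id : G → G)).toMonoidHom.ker) := by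
      intro w
      have hw := mem_center_iff.1 hz (f w)
      exact ⟨hcover.mem_mCommutator_ker hfin hf (star_mem_mCommutator t (Subgroup.mem_top w))
          ((f.map_star t w).trans hw.1),
        hcover.mem_mCommutator_ker hfin hf (commutator_mem_mCommutator t (Subgroup.mem_top w))
          ((map_commutatorElement f t w).trans hw.2)⟩
    refine Subgroup.mem_sInf.2 ?_
    rintro _ ⟨A, E, _, _, κ, ψ, hψ, rfl⟩
    obtain ⟨g, hg⟩ := hψ.exists_lift
    exact ⟨g t, map_mem_center_of_mem_centerMod hψ surjective_lift_id hg ht,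
      (hg t).trans (hf t).symm⟩
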